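/- Let $D\ge 3$ and $S=\{1,\dots,2D+1\}$. The folded cube $\square_{2D+1}$ is the graph whose vertex set $X$ consists of the pairs $x=(x_1,x_2)$ of complementary subsets of $S$ with $|x_1|<|x_2|$, where $x,y$ are adjacent iff $\min\{|x_i\triangle y_j| : i,j\in\{1,2\}\}=1$. Let $\mathbf 0=(\emptyset,S)$, let $\partial$ be the path-length distance, and let $T\subseteq \mathrm{Mat}_X(\mathbb C)$ be the Terwilliger algebra of $\square_{2D+1}$ with respect to $\mathbf 0$, i.e. the subalgebra generated by the Bose–Mesner algebra (spanned by the distance matrices $A_i$, with $(A_i)_{xy}=1$ if $\partial(x,y)=i$ and $0$ otherwise) and the dual Bose–Mesner algebra (spanned by the diagonal matrices $E_i^*$, with $(E_i^*)_{yy}=1$ if $\partial(\mathbf 0,y)=i$ and $0$ otherwise). For integers $i,j,t\ge 0$ let $M^t_{i,j}\in\mathrm{Mat}_X(\mathbb C)$ have $(x,y)$-entry $1$ if $|x_1|=i$, $|y_1|=j$, $|x_1\cap y_1|=t$, and $0$ otherwise. For $0\le r\le D$ let $$\mathcal L'_r=\{\xi\in\mathbb C^X : M^{r-1}_{r-1,r}\xi=0,\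 \xi_{(x_1,x_2)}=0 \text{ if } |x_1|\ne r\}$$ (the first condition being void for $r=0$), let $B'_r$ be any orthonormal basis of $\mathcal L'_r$ for the standard Hermitian inner product, and put $N_r=\{r,r+1,\dots,D\}$. Let $U'$ be the matrix with rows indexed by $X$ and columns indexed by $\mathcal B'=\{(r,\xi,i) : 0\le r\le D,\ \xi\in B'_r,\ i\in N_r\}$ whose $(r,\xi,i)$-th column is $$u_{r,\xi,i}=\binom{2D+1-2r}{i-r}^{-1/2}M^r_{i,r}\,\xi .$$ Then $U'$ block-diagonalizes $T$ and $T\cong\bigoplus_{r=0}^D\mathbb C^{N_r\times N_r}$. Precisely: $|B'_r|=\binom{2D+1}{r}-\binom{2D+1}{r-1}$ for $0\le r\le D$ (with $\binom{2D+1}{-1}=0$); $U'$ is unitary, i.e. $U'^*U'=I$ and $U'U'^*=I$; and there is an isomorphism of $\mathbb C$-algebras $\varphi=(\varphi_0,\dots,\varphi_D): T\to\bigoplus_{r=0}^D\mathbb C^{N_r\times N_r}$ such that for every $Y\in T$ and all $(r,\xi,i),(r',\xi',j)\in\mathcal B'$, $$(U'^*YU')_{(r,\xi,i),(r',\xi',j)}=\begin{cases}\varphi_r(Y)_{ij}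 & \text{if } r=r',\ \xi=\xi',\\ 0&\text{otherwise,}\end{cases}$$ so that $U'^*YU'$ is block diagonal with $|B'_r|$ equal copies of the block $\varphi_r(Y)$ for each $r$. (If the bases $B'_r$ consist of real vectors, then $U'^*=U'^{\mathrm T}$.) -/

import Mathlib

open scoped Matrix Kronecker

noncomputable section

/-- The `i`-th distance matrix of a (connected) graph: the `(x, y)`-entry is `1` if the path-length
distance of `x` and `y` is `i`, and `0` otherwise. It vanishes for `i` greater than the diameter. -/
def distanceMatrix {V : Type*} (G : SimpleGraph V) (i : ℕ) : Matrix V V ℂ :=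
  Matrix.of fun x y => if G.dist x y = i then 1 else 0

/-- The `i`-th dual idempotent with respect to `x`: the diagonal matrix with `(y, y)`-entry `1` if
`y` is at distance `i` from `x`, and `0` otherwise. It vanishes for `i` greater than the
diameter. -/
def dualIdempotent {V : Type*} [DecidableEq V] (G : SimpleGraph V) (x : V) (i : ℕ) :
    Matrix V V ℂ :=
  Matrix.diagonal fun y => if G.dist x y = i then 1 else 0

/-- The Bose-Mesner algebra, as the span of the distance matrices. -/
def boseMesner {V : Type*} (G : SimpleGraph V) : Submodule ℂ (Matrix V V ℂ) :=
  Submodule.span ℂ (Set.range (distanceMatrix G))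

/-- The dual Bose-Mesner algebra with respect to `x`, as the span of the dual idempotents. -/
def dualBoseMesner {V : Type*} [DecidableEq V] (G : SimpleGraph V) (x : V) :
    Submodule ℂ (Matrix V V ℂ) :=
  Submodule.span ℂ (Set.range (dualIdempotent G x))

/-- The Terwilliger algebra with respect to `x`: the subalgebra of the full matrix algebra generated
by the Bose-Mesner algebra and the dual Bose-Mesner algebra. -/
def terwilligerAlgebra {V : Type*} [Fintype V] [DecidableEq V] (G : SimpleGraph V) (x : V) :
    Subalgebra ℂ (Matrix V V ℂ) :=
  Algebra.adjoin ℂ ((boseMesner G : Set (Matrix V V ℂ)) ∪ (dualBoseMesner G x : Set (Matrix V V ℂ)))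

namespace FoldedCube

/-- Vertices of the folded `(2D+1)`-cube: the pairs `(x₁, x₂)` of complementary subsets of a
`(2D+1)`-set with `|x₁| < |x₂|`. Such a pair is recorded by its first member. -/
abbrev Vertex (D : ℕ) : Type :=
  {u : Finset (Fin (2 * D + 1)) // u.card < uᶜ.card}

/-- The smaller member `x₁` of the pair `(x₁, x₂)`. -/
def Vertex.fst {D : ℕ} (x : Vertex D) : Finset (Fin (2 * D + 1)) := x.1

/-- The larger member `x₂` of the pair `(x₁, x₂)`. -/
def Vertex.snd {D : ℕ} (x : Vertex D) : Finset (Fin (2 * D + 1)) := x.1ᶜ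

/-- The vertex `(∅, S)`. -/
def zero (D : ℕ) : Vertex D := ⟨∅, by simp⟩

/-- The least of the four Hamming distances `|xᵢ ∆ yⱼ|`. -/
def minDist {D : ℕ} (x y : Vertex D) : ℕ :=
  min (min (symmDiff x.fst y.fst).card (symmDiff x.fst y.snd).card)
    (min (symmDiff x.snd y.fst).card (symmDiff x.snd y.snd).card)

theorem minDist_comm {D : ℕ} (x y : Vertex D) : minDist x y = minDist y x := by
  unfold minDist
  rw [symmDiff_comm x.fst y.fst, symmDiff_comm x.fst y.snd, symmDiff_comm x.snd y.fst,
    symmDiff_comm x.snd y.snd, min_min_min_comm]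

theorem minDist_self {D : ℕ} (x : Vertex D) : minDist x x = 0 := by
  simp [minDist]

/-- The folded `(2D+1)`-cube: `x` and `y` are adjacent when the least of the Hamming distances
`|xᵢ ∆ yⱼ|` is `1`. -/
def graph (D : ℕ) : SimpleGraph (Vertex D) where
  Adj x y := minDist x y = 1
  symm := ⟨fun x y h => (minDist_comm y x).trans h⟩
  loopless := ⟨fun x h => by simp [minDist_self] at h⟩

/-- The Terwilliger algebra of the folded `(2D+1)`-cube with respect to the vertex `(∅, S)`. -/
def T (D : ℕ) : Subalgebra ℂ (Matrix (Vertex D) (Vertex D) ℂ) :=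
  terwilligerAlgebra (graph D) (zero D)

/-- The matrix `M^t_{i,j}`: the `(x, y)`-entry is `1` if `|x₁| = i`, `|y₁| = j` and
`|x₁ ∩ y₁| = t`, and `0` otherwise. -/
def M (D t i j : ℕ) : Matrix (Vertex D) (Vertex D) ℂ :=
  Matrix.of fun x y =>
    if x.fst.card = i ∧ y.fst.card = j ∧ (x.fst ∩ y.fst).card = t then 1 else 0

/-- The space `L_r` of the vectors `ξ` supported on the vertices with `|x₁| = r` and satisfying
`M^{r-1}_{r-1,r} ξ = 0`; the latter condition is void for `r = 0`. -/
def L (D r : ℕ) : Submodule ℂ (EuclideanSpace ℂ (Vertex D)) where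
  carrier := {ξ | (∀ s, s + 1 = r → M D s s r *ᵥ ξ.ofLp = 0) ∧
    ∀ x : Vertex D, x.fst.card ≠ r → ξ x = 0}
  add_mem' := by
    rintro a b ⟨ha, ha'⟩ ⟨hb, hb'⟩
    refine ⟨fun s hs => ?_, fun x hx => ?_⟩
    · simp [Matrix.mulVec_add, ha s hs, hb s hs]
    · simp [ha' x hx, hb' x hx]
  zero_mem' := by
    refine ⟨fun s _ => ?_, fun x _ => ?_⟩ <;> simp
  smul_mem' := by
    rintro c a ⟨ha, ha'⟩
    refine ⟨fun s hs => ?_, fun x hx => ?_⟩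
    · simp [Matrix.mulVec_smul, ha s hs]
    · simp [ha' x hx]

/-- The index set `N_r = {r, r+1, …, D}`. -/
abbrev N (D r : ℕ) : Type := ↥(Finset.Icc r D)

/-- The vector `u_{r,ξ,i} = C(2D+1-2r, i-r)^{-1/2} M^r_{i,r} ξ`. -/
def u (D r : ℕ) (ξ : EuclideanSpace ℂ (Vertex D)) (i : ℕ) : Vertex D → ℂ :=
  ((((2 * D + 1 - 2 * r).choose (i - r) : ℝ) ^ (-(1 / 2) : ℝ) : ℝ) : ℂ) • (M D r i r *ᵥ ξ.ofLp)

/-- The index set of the triples `(r, ξ, i)` with `0 ≤ r ≤ D`, `ξ` a member of the chosen basis of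
`L_r` (these members being indexed by `ι r`) and `r ≤ i ≤ D`. -/
abbrev TripleIndex (D : ℕ) (ι : Fin (D + 1) → Type*) : Type _ :=
  Σ r : Fin (D + 1), ι r × N D r

/-- The matrix `U'` whose `(r, ξ, i)`-th column is `u_{r,ξ,i}`, for chosen orthonormal bases `B r` of
the spaces `L_r`. -/
def U {D : ℕ} {ι : Fin (D + 1) → Type*} [∀ r, Fintype (ι r)]
    (B : ∀ r : Fin (D + 1), OrthonormalBasis (ι r) ℂ (L D r)) :
    Matrix (Vertex D) (TripleIndex D ι) ℂ :=
  Matrix.of fun x p => u D p.1 (B p.1 p.2.1 : EuclideanSpace ℂ (Vertex D)) p.2.2 x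

end FoldedCube

end

namespace FoldedCube

/-! The algebra is controlled by the inclusion matrices "up" $M^s_{i,s}$ and "down" $M^s_{s,i}$. A
Vandermonde expansion (`M_down_mul_M_up`) rewrites down·up through up·down; on $\mathcal L'_r$ all
but one term vanish, so the columns of $U'$ are orthonormal. Unitarity and the dimensions then come
from one count. Rank-nullity bounds $\dim\mathcal L'_r$ below by
$\binom{2D+1}{r}-\binom{2D+1}{r-1}$, orthonormality bounds the number of columns above by $|X|$, and
the lower bounds weighted by $D+1-r$ already sum to $|X|$. Hence equality holds everywhere
(`card_basis_and_card_tripleIndex`). Conjugation by $U'$ therefore embeds $\bigoplus_r\mathbb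
C^{N_r\times N_r}$ in $\mathrm{Mat}_X(\mathbb C)$, and it remains to see that the image is $T$.
Inclusion matrices send $u_{r,\xi,s}$ to multiples of $u_{r,\xi,k}$, so they lie in the image, and
so does every $M^t_{i,j}$ by triangular inversion, hence $T$. Conversely, up·down products yield all
matrix units of the blocks by induction on $r$, and $T$ contains the inclusion matrices because
those between consecutive levels are $E^*_{i\pm1}A_1E^*_i$. -/

theorem card_fst_le {D : ℕ} (x : Vertex D) : x.fst.card ≤ D := by
  have h := x.2
  rw [Finset.card_compl, Fintype.card_fin] at h
  simp only [Vertex.fst]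
  omega

theorem card_lt_card_compl_iff {D : ℕ} (s : Finset (Fin (2 * D + 1))) :
    s.card < sᶜ.card ↔ s.card ≤ D := by
  rw [Finset.card_compl, Fintype.card_fin]
  have := s.card_le_univ
  rw [Fintype.card_fin] at this
  omega

/-- The number of `s`-sets between `z` and `x`. -/
theorem card_filter_between {α : Type*} [Fintype α] [DecidableEq α] {z x : Finset α} {s : ℕ}
    (hzx : z ⊆ x) (hs : z.card ≤ s) :
    (Finset.univ.filter fun y : Finset α => y.card = s ∧ z ⊆ y ∧ y ⊆ x).card =
      (x.card - z.card).choose (s - z.card) := by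
  rw [← Finset.card_sdiff_of_subset hzx, ← Finset.card_powersetCard]
  refine Finset.card_bij' (fun y _ => y \ z) (fun y _ => y ∪ z) ?_ ?_ ?_ ?_
  · intro y hy
    simp only [Finset.mem_filter, Finset.mem_univ, true_and] at hy
    rw [Finset.mem_powersetCard, Finset.card_sdiff_of_subset hy.2.1, hy.1]
    exact ⟨Finset.sdiff_subset_sdiff hy.2.2 le_rfl, rfl⟩
  · intro y hy
    rw [Finset.mem_powersetCard] at hy
    have hd : Disjoint y z := Finset.disjoint_of_subset_left hy.1 Finset.sdiff_disjoint
    simp only [Finset.mem_filter, Finset.mem_univ, true_and]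
    refine ⟨?_, Finset.subset_union_right,
      Finset.union_subset (hy.1.trans Finset.sdiff_subset) hzx⟩
    rw [Finset.card_union_of_disjoint hd, hy.2]
    omega
  · intro y hy
    simp only [Finset.mem_filter, Finset.mem_univ, true_and] at hy
    exact Finset.sdiff_union_of_subset hy.2.1
  · intro y hy
    rw [Finset.mem_powersetCard] at hy
    have hd : Disjoint y z := Finset.disjoint_of_subset_left hy.1 Finset.sdiff_disjoint
    exact Finset.union_sdiff_cancel_right hd

/-- Counting vertices by counting sets with at most `D` elements. -/
theorem sum_vertex_ite {D : ℕ} (p : Finset (Fin (2 * D + 1)) → Prop) [DecidablePred p]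
    (hp : ∀ y, p y → y.card ≤ D) :
    (∑ y : Vertex D, if p y.fst then (1 : ℂ) else 0) = ((Finset.univ.filter p).card : ℂ) := by
  rw [Finset.sum_boole]
  congr 1
  refine Finset.card_bij (fun y _ => y.fst) ?_ ?_ ?_
  · intro y hy
    simpa using hy
  · intro a _ b _ h
    exact Subtype.ext h
  · intro y hy
    simp only [Finset.mem_filter, Finset.mem_univ, true_and] at hy
    exact ⟨⟨y, (card_lt_card_compl_iff y).2 (hp y hy)⟩,
      Finset.mem_filter.2 ⟨Finset.mem_univ _, hy⟩, rfl⟩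

theorem card_inter_eq_left_iff {α : Type*} [DecidableEq α] {a b : Finset α} {r : ℕ}
    (hr : a.card = r) : (a ∩ b).card = r ↔ a ⊆ b := by
  subst hr
  refine ⟨fun h => ?_, fun h => by rw [Finset.inter_eq_left.2 h]⟩
  rw [← Finset.inter_eq_left]
  exact Finset.eq_of_subset_of_card_le Finset.inter_subset_left h.ge

theorem card_inter_eq_right_iff {α : Type*} [DecidableEq α] {a b : Finset α} {r : ℕ}
    (hr : b.card = r) : (a ∩ b).card = r ↔ b ⊆ a := by
  rw [Finset.inter_comm, card_inter_eq_left_iff hr]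

/-! ### Products of inclusion matrices -/

theorem M_apply (D t i j : ℕ) (x y : Vertex D) :
    M D t i j x y =
      if x.fst.card = i ∧ y.fst.card = j ∧ (x.fst ∩ y.fst).card = t then 1 else 0 := rfl

/-- The inclusion matrix of sets of size `s` in sets of size `i`. -/
theorem M_up_apply (D s i : ℕ) (x y : Vertex D) :
    M D s i s x y = if x.fst.card = i ∧ y.fst.card = s ∧ y.fst ⊆ x.fst then 1 else 0 := by
  rw [M_apply]
  refine if_congr (and_congr_right fun _ => and_congr_right fun h => ?_) rfl rfl
  exact card_inter_eq_right_iff h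

theorem M_down_apply (D s i : ℕ) (x y : Vertex D) :
    M D s s i x y = if x.fst.card = s ∧ y.fst.card = i ∧ x.fst ⊆ y.fst then 1 else 0 := by
  rw [M_apply]
  refine if_congr (and_congr_right fun h => and_congr_right fun _ => ?_) rfl rfl
  exact card_inter_eq_left_iff h

theorem M_transpose (D t i j : ℕ) : (M D t i j)ᵀ = M D t j i := by
  ext x y
  rw [Matrix.transpose_apply, M_apply, M_apply, Finset.inter_comm]
  exact if_congr (by tauto) rfl rfl

theorem M_conjTranspose (D t i j : ℕ) : (M D t i j)ᴴ = M D t j i := by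
  rw [← M_transpose D t i j]
  ext x y
  rw [Matrix.conjTranspose_apply, Matrix.transpose_apply, M_apply]
  split_ifs <;> simp

theorem M_eq_zero_left {D t i j : ℕ} (h : i < t) : M D t i j = 0 := by
  ext x y
  rw [M_apply, if_neg, Matrix.zero_apply]
  rintro ⟨h1, h2, h3⟩
  have := Finset.card_le_card (Finset.inter_subset_left (s₁ := x.fst) (s₂ := y.fst))
  omega

theorem M_eq_zero_right {D t i j : ℕ} (h : j < t) : M D t i j = 0 := by
  rw [← M_transpose, M_eq_zero_left h, Matrix.transpose_zero]

theorem M_mul_M_of_ne {D t i j t' j' k : ℕ} (h : j ≠ j') : M D t i j * M D t' j' k = 0 := by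
  ext x z
  rw [Matrix.mul_apply, Matrix.zero_apply]
  refine Finset.sum_eq_zero fun y _ => ?_
  rw [M_apply, M_apply, ite_zero_mul_ite_zero, if_neg]
  rintro ⟨⟨_, h1, _⟩, h2, _⟩
  exact h (h1.symm.trans h2)

/-- The entry counts the $s$-sets between $z_1$ and $x_1$; being subsets of $x_1$, they are all
vertices. -/
theorem M_up_mul_M_up (D : ℕ) {r s : ℕ} (k : ℕ) (hrs : r ≤ s) :
    M D s k s * M D r s r = ((k - r).choose (s - r) : ℂ) • M D r k r := by
  ext x z
  rw [Matrix.mul_apply, Matrix.smul_apply, M_up_apply, smul_eq_mul]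
  simp only [M_up_apply, ite_zero_mul_ite_zero, mul_one]
  by_cases hx : x.fst.card = k ∧ z.fst.card = r ∧ z.fst ⊆ x.fst
  · rw [if_pos hx, mul_one]
    obtain ⟨rfl, rfl, hzx⟩ := hx
    rw [← card_filter_between hzx hrs, ← sum_vertex_ite]
    · refine Finset.sum_congr rfl fun y _ => if_congr (by tauto) rfl rfl
    · rintro y ⟨_, _, h⟩
      exact (Finset.card_le_card h).trans (card_fst_le x)
  · rw [if_neg hx, mul_zero]
    refine Finset.sum_eq_zero fun y _ => if_neg ?_
    rintro ⟨⟨h1, h2, h3⟩, h4, h5, h6⟩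
    exact hx ⟨h1, h5, h6.trans h3⟩

theorem M_down_mul_M_down (D : ℕ) {r s : ℕ} (k : ℕ) (hrs : r ≤ s) :
    M D r r s * M D s s k = ((k - r).choose (s - r) : ℂ) • M D r r k := by
  rw [← M_transpose D r s r, ← M_transpose D s k s, ← Matrix.transpose_mul, M_up_mul_M_up D k hrs,
    Matrix.transpose_smul, M_transpose]

theorem M_up_mul_M_down_apply (D s i j : ℕ) (x z : Vertex D) :
    (M D s i s * M D s s j) x z =
      if x.fst.card = i ∧ z.fst.card = j then ((x.fst ∩ z.fst).card.choose s : ℂ) else 0 := by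
  rw [Matrix.mul_apply]
  simp only [M_up_apply, M_down_apply, ite_zero_mul_ite_zero, mul_one]
  split_ifs with hx
  · have := card_filter_between (Finset.empty_subset (x.fst ∩ z.fst)) (Nat.zero_le s)
    rw [Finset.card_empty, Nat.sub_zero, Nat.sub_zero] at this
    rw [← this, ← sum_vertex_ite]
    · refine Finset.sum_congr rfl fun y _ => if_congr ?_ rfl rfl
      rw [Finset.subset_inter_iff]
      have := Finset.empty_subset y.fst
      tauto
    · rintro y ⟨_, _, h⟩
      exact (Finset.card_le_card (h.trans Finset.inter_subset_left)).trans (card_fst_le x)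
  · refine Finset.sum_eq_zero fun y _ => if_neg ?_
    tauto

/-- The entry counts $i$-sets containing $y_1\cup z_1$, all of them vertices as $i\le D$. Counting
by complements puts $|y_1\cap z_1|$ additively in the upper index, ready for Vandermonde. -/
theorem M_down_mul_M_up_apply {D i : ℕ} (hi : i ≤ D) (r r' : ℕ) (y z : Vertex D) :
    (M D r r i * M D r' i r') y z =
      if y.fst.card = r ∧ z.fst.card = r' then
        ((2 * D + 1 - (y.fst ∪ z.fst).card).choose (2 * D + 1 - i) : ℂ) else 0 := by
  rw [Matrix.mul_apply]
  simp only [M_up_apply, M_down_apply, ite_zero_mul_ite_zero, mul_one]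
  split_ifs with hx
  · have hs : ∑ x : Vertex D, (if (y.fst.card = r ∧ x.fst.card = i ∧ y.fst ⊆ x.fst) ∧
        x.fst.card = i ∧ z.fst.card = r' ∧ z.fst ⊆ x.fst then (1 : ℂ) else 0) =
        ((Finset.univ.filter fun x : Finset (Fin (2 * D + 1)) =>
          x.card = i ∧ y.fst ∪ z.fst ⊆ x ∧ x ⊆ Finset.univ).card : ℂ) := by
      rw [← sum_vertex_ite]
      · refine Finset.sum_congr rfl fun x _ => if_congr ?_ rfl rfl
        rw [Finset.union_subset_iff]
        have := Finset.subset_univ x.fst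
        tauto
      · rintro x ⟨h, _⟩
        omega
    rw [hs]
    by_cases hc : (y.fst ∪ z.fst).card ≤ i
    · rw [card_filter_between (Finset.subset_univ _) hc, Finset.card_univ, Fintype.card_fin,
        ← Nat.choose_symm (by omega)]
      congr 2
      omega
    · rw [Nat.choose_eq_zero_of_lt (by omega), Finset.filter_false_of_mem, Finset.card_empty]
      rintro x - ⟨h1, h2, _⟩
      exact hc (h1 ▸ Finset.card_le_card h2)
  · refine Finset.sum_eq_zero fun x _ => if_neg ?_
    tauto

/-- The products "down after up" in terms of the products "up after down". -/
theorem M_down_mul_M_up {D r r' i : ℕ} (hi : i ≤ D) (hr : r ≤ D) (hr' : r' ≤ D) :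
    M D r r i * M D r' i r' = ∑ s ∈ Finset.range (2 * D + 1 - i + 1),
      ((2 * D + 1 - r - r').choose (2 * D + 1 - i - s) : ℂ) • (M D s r s * M D s s r') := by
  ext y z
  simp only [Matrix.sum_apply, Matrix.smul_apply, M_up_mul_M_down_apply, smul_eq_mul]
  rw [M_down_mul_M_up_apply hi]
  split_ifs with h
  · obtain ⟨rfl, rfl⟩ := h
    have h1 := Finset.card_union_add_card_inter y.fst z.fst
    -- Vandermonde applied to this sum produces $\binom{|y_1\cap z_1|}{s}$, the entry of the up·down
    -- product at level $s$.
    have h2 : 2 * D + 1 - (y.fst ∪ z.fst).card =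
        (y.fst ∩ z.fst).card + (2 * D + 1 - y.fst.card - z.fst.card) := by
      have := Finset.card_le_univ (y.fst ∪ z.fst)
      rw [Fintype.card_fin] at this
      omega
    rw [h2, Nat.add_choose_eq, Finset.Nat.sum_antidiagonal_eq_sum_range_succ_mk]
    push_cast
    exact Finset.sum_congr rfl fun s _ => mul_comm _ _
  · simp

theorem M_diag_mulVec {D r : ℕ} {ξ : EuclideanSpace ℂ (Vertex D)} (hξ : ξ ∈ L D r) :
    M D r r r *ᵥ ξ.ofLp = ξ.ofLp := by
  funext x
  rw [Matrix.mulVec, dotProduct, Finset.sum_eq_single x]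
  · rw [M_apply, Finset.inter_self]
    by_cases h : x.fst.card = r
    · simp [h]
    · have := hξ.2 x h
      simp [h, this]
  · intro y _ hy
    rw [M_up_apply, if_neg, zero_mul]
    rintro ⟨h1, h2, h3⟩
    exact hy (Subtype.ext (Finset.eq_of_subset_of_card_le h3 (h1.trans h2.symm).le))
  · simp

/-- Up to a nonzero binomial factor, going down from $r$ to $s$ factors through level $r-1$, where
$\xi$ is killed. -/
theorem M_down_mulVec_eq_zero {D r s : ℕ} {ξ : EuclideanSpace ℂ (Vertex D)} (hξ : ξ ∈ L D r)
    (hs : s < r) : M D s s r *ᵥ ξ.ofLp = 0 := by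
  obtain ⟨k, rfl⟩ : ∃ k, r = k + 1 := ⟨r - 1, by omega⟩
  have h := congrArg (· *ᵥ ξ.ofLp) (M_down_mul_M_down D (k + 1) (Nat.lt_succ_iff.1 hs))
  simp only [← Matrix.mulVec_mulVec, hξ.1 k rfl, Matrix.mulVec_zero, Matrix.smul_mulVec] at h
  refine (smul_eq_zero.1 h.symm).resolve_left ?_
  exact_mod_cast (Nat.choose_pos (by omega)).ne'

end FoldedCube

/-! ### Orthonormality of the columns -/

namespace FoldedCube

/-- In the up·down expansion, terms with $s<r'$ annihilate $\xi$ and those with $s>r'$ are zero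
matrices. The term $s=r'$ needs $r\ge r'$, which leaves only $r=r'$. -/
theorem M_mul_M_mulVec {D r r' i : ℕ} (hi : i ≤ D) (hr : r ≤ r') (hr' : r' ≤ i)
    {ξ : EuclideanSpace ℂ (Vertex D)} (hξ : ξ ∈ L D r') :
    (M D r r i * M D r' i r') *ᵥ ξ.ofLp =
      if r = r' then ((2 * D + 1 - 2 * r').choose (i - r') : ℂ) • ξ.ofLp else 0 := by
  rw [M_down_mul_M_up hi (by omega) (by omega), Matrix.sum_mulVec,
    Finset.sum_eq_single_of_mem r' (Finset.mem_range.2 (by omega))]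
  · rw [Matrix.smul_mulVec, ← Matrix.mulVec_mulVec, M_diag_mulVec hξ]
    split_ifs with h
    · subst h
      rw [M_diag_mulVec hξ, ← Nat.choose_symm (by omega)]
      congr 3 <;> omega
    · rw [M_eq_zero_left (by omega), Matrix.zero_mulVec, smul_zero]
  · intro s _ hs
    rw [Matrix.smul_mulVec, ← Matrix.mulVec_mulVec]
    rcases lt_or_gt_of_ne hs with h | h
    · rw [M_down_mulVec_eq_zero hξ h, Matrix.mulVec_zero, smul_zero]
    · rw [M_eq_zero_right h, Matrix.zero_mulVec, Matrix.mulVec_zero, smul_zero]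

theorem star_M_mulVec_dotProduct {D r r' i j : ℕ} (v w : Vertex D → ℂ) :
    star (M D r i r *ᵥ v) ⬝ᵥ (M D r' j r' *ᵥ w) =
      star v ⬝ᵥ ((M D r r i * M D r' j r') *ᵥ w) := by
  rw [Matrix.star_mulVec, M_conjTranspose, ← Matrix.dotProduct_mulVec, Matrix.mulVec_mulVec]

theorem star_M_mulVec_dotProduct_of_ne {D r r' i j : ℕ} (h : r ≠ r' ∨ i ≠ j) (hi : i ≤ D)
    (hr : r ≤ i) (hr' : r' ≤ j) {ξ ξ' : EuclideanSpace ℂ (Vertex D)}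
    (hξ : ξ ∈ L D r) (hξ' : ξ' ∈ L D r') :
    star (M D r i r *ᵥ ξ.ofLp) ⬝ᵥ (M D r' j r' *ᵥ ξ'.ofLp) = 0 := by
  by_cases hij : i = j
  · subst hij
    have hne := h.resolve_right (not_not.2 rfl)
    rcases le_total r r' with hrr | hrr
    · rw [star_M_mulVec_dotProduct, M_mul_M_mulVec hi hrr hr' hξ', if_neg hne, dotProduct_zero]
    · rw [← star_eq_zero, Matrix.star_dotProduct, star_star,
        star_M_mulVec_dotProduct, M_mul_M_mulVec hi hrr hr hξ, if_neg hne.symm, dotProduct_zero]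
  · rw [star_M_mulVec_dotProduct, M_mul_M_of_ne hij, Matrix.zero_mulVec, dotProduct_zero]

theorem star_M_mulVec_dotProduct_self {D r i : ℕ} (hi : i ≤ D) (hr : r ≤ i)
    (v : Vertex D → ℂ) {ξ : EuclideanSpace ℂ (Vertex D)} (hξ : ξ ∈ L D r) :
    star (M D r i r *ᵥ v) ⬝ᵥ (M D r i r *ᵥ ξ.ofLp) =
      ((2 * D + 1 - 2 * r).choose (i - r) : ℂ) * (star v ⬝ᵥ ξ.ofLp) := by
  rw [star_M_mulVec_dotProduct, M_mul_M_mulVec hi le_rfl hr hξ, if_pos rfl, dotProduct_smul,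
    smul_eq_mul]

/-- The normalizing factor of the vector `u D r ξ i`. -/
noncomputable def normFactor (D r i : ℕ) : ℂ :=
  ((((2 * D + 1 - 2 * r).choose (i - r) : ℝ) ^ (-(1 / 2) : ℝ) : ℝ) : ℂ)

theorem u_eq (D r i : ℕ) (ξ : EuclideanSpace ℂ (Vertex D)) :
    u D r ξ i = normFactor D r i • (M D r i r *ᵥ ξ.ofLp) := rfl

theorem star_normFactor (D r i : ℕ) : star (normFactor D r i) = normFactor D r i :=
  Complex.conj_ofReal _

theorem normFactor_ne_zero {D r i : ℕ} (hi : i ≤ D) (hr : r ≤ i) : normFactor D r i ≠ 0 := by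
  have h : (0 : ℝ) < ((2 * D + 1 - 2 * r).choose (i - r) : ℝ) := by
    exact_mod_cast Nat.choose_pos (by omega)
  rw [normFactor, Complex.ofReal_ne_zero]
  exact (Real.rpow_pos_of_pos h _).ne'

theorem normFactor_mul_self {D r i : ℕ} (hi : i ≤ D) (hr : r ≤ i) :
    normFactor D r i * normFactor D r i * ((2 * D + 1 - 2 * r).choose (i - r) : ℂ) = 1 := by
  have h : (0 : ℝ) < ((2 * D + 1 - 2 * r).choose (i - r) : ℝ) := by
    exact_mod_cast Nat.choose_pos (by omega)
  have : (((2 * D + 1 - 2 * r).choose (i - r) : ℕ) : ℂ) =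
    (((2 * D + 1 - 2 * r).choose (i - r) : ℝ) : ℂ) := by push_cast; rfl
  rw [this, normFactor, ← Complex.ofReal_mul, ← Complex.ofReal_mul, ← Real.rpow_add h]
  rw [show (-(1 / 2) + -(1 / 2) : ℝ) = -1 by norm_num, Real.rpow_neg_one,
    inv_mul_cancel₀ h.ne', Complex.ofReal_one]

theorem N_prop {D r : ℕ} (i : N D r) : r ≤ i ∧ (i : ℕ) ≤ D := Finset.mem_Icc.1 i.2

section Basis

variable {D : ℕ} {ι : Fin (D + 1) → Type*} [∀ r, Fintype (ι r)]

theorem star_basis_dotProduct [∀ r, DecidableEq (ι r)]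
    (B : ∀ r : Fin (D + 1), OrthonormalBasis (ι r) ℂ (L D r))
    (r : Fin (D + 1)) (k l : ι r) :
    star (B r k : EuclideanSpace ℂ (Vertex D)).ofLp ⬝ᵥ
      (B r l : EuclideanSpace ℂ (Vertex D)).ofLp = if k = l then 1 else 0 := by
  have h := orthonormal_iff_ite.1 (B r).orthonormal k l
  rwa [Submodule.coe_inner, EuclideanSpace.inner_eq_star_dotProduct, dotProduct_comm] at h

theorem conjTranspose_U_mul_U [∀ r, DecidableEq (ι r)]
    (B : ∀ r : Fin (D + 1), OrthonormalBasis (ι r) ℂ (L D r)) : (U B)ᴴ * U B = 1 := by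
  ext ⟨r, k, i⟩ ⟨r', l, j⟩
  have hi := N_prop i
  have hj := N_prop j
  have h : ((U B)ᴴ * U B) ⟨r, k, i⟩ ⟨r', l, j⟩ = normFactor D r i * normFactor D r' j *
      (star (M D r i r *ᵥ (B r k : EuclideanSpace ℂ (Vertex D)).ofLp) ⬝ᵥ
        (M D r' j r' *ᵥ (B r' l : EuclideanSpace ℂ (Vertex D)).ofLp)) := by
    change star (u D r (B r k : EuclideanSpace ℂ (Vertex D)) i) ⬝ᵥ
      (u D r' (B r' l : EuclideanSpace ℂ (Vertex D)) j) = _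
    rw [u_eq, u_eq, star_smul, smul_dotProduct, dotProduct_smul, star_normFactor, smul_eq_mul,
      smul_eq_mul, mul_assoc]
  rw [h]
  by_cases hr : r = r'
  · subst hr
    by_cases hij : i = j
    · subst hij
      rw [star_M_mulVec_dotProduct_self hi.2 hi.1 _ (B r l).2, ← mul_assoc,
        normFactor_mul_self hi.2 hi.1, one_mul, star_basis_dotProduct, Matrix.one_apply]
      refine if_congr ?_ rfl rfl
      simp
    · rw [star_M_mulVec_dotProduct_of_ne (Or.inr fun h => hij (Subtype.ext h)) hi.2 hi.1 hj.1
        (B r k).2 (B r l).2, mul_zero, Matrix.one_apply_ne]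
      simp [hij]
  · rw [star_M_mulVec_dotProduct_of_ne (Or.inl fun h => hr (Fin.ext h)) hi.2 hi.1 hj.1
        (B r k).2 (B r' l).2, mul_zero, Matrix.one_apply_ne]
    simp [hr]

/-- Orthonormal columns are independent, so the rank bounds their number. -/
theorem card_tripleIndex_le [∀ r, DecidableEq (ι r)]
    (B : ∀ r : Fin (D + 1), OrthonormalBasis (ι r) ℂ (L D r)) :
    Fintype.card (TripleIndex D ι) ≤ Fintype.card (Vertex D) := by
  rw [← Matrix.rank_one (R := ℂ) (n := TripleIndex D ι), ← conjTranspose_U_mul_U B]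
  exact (Matrix.rank_mul_le_right _ _).trans (Matrix.rank_le_card_height _)

theorem card_tripleIndex (D : ℕ) (ι : Fin (D + 1) → Type*) [∀ r, Fintype (ι r)] :
    Fintype.card (TripleIndex D ι) = ∑ r : Fin (D + 1), Fintype.card (ι r) * (D + 1 - r) := by
  rw [Fintype.card_sigma]
  refine Finset.sum_congr rfl fun r _ => ?_
  rw [Fintype.card_prod, Fintype.card_coe, Nat.card_Icc]

/-! ### Dimension count and unitarity -/

theorem card_vertex_fst_eq {D i : ℕ} (hi : i ≤ D) :
    Fintype.card {x : Vertex D // x.fst.card = i} = (2 * D + 1).choose i := by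
  have h := sum_vertex_ite (D := D) (fun y => y.card = i) (fun y hy => hy.trans_le hi)
  rw [Finset.sum_boole, Nat.cast_inj] at h
  rw [Fintype.card_subtype, h, ← Fintype.card_subtype, Fintype.card_finset_len, Fintype.card_fin]

theorem card_vertex (D : ℕ) :
    Fintype.card (Vertex D) = ∑ i ∈ Finset.range (D + 1), (2 * D + 1).choose i := by
  rw [← Finset.card_univ, Finset.card_eq_sum_card_fiberwise (f := fun x : Vertex D => x.fst.card)
    (t := Finset.range (D + 1)) fun x _ => by simpa [Nat.lt_succ_iff] using card_fst_le x]
  refine Finset.sum_congr rfl fun i hi => ?_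
  rw [← card_vertex_fst_eq (Nat.lt_succ_iff.1 (Finset.mem_range.1 hi)), Fintype.card_subtype]

/-- The number `C(n, r) - C(n, r - 1)`. -/
def chooseDiff (n r : ℕ) : ℤ :=
  (n.choose r : ℤ) - (if r = 0 then 0 else (n.choose (r - 1) : ℤ))

theorem sum_chooseDiff (n m : ℕ) :
    ∑ r ∈ Finset.range (m + 1), chooseDiff n r = n.choose m := by
  induction m with
  | zero => simp [chooseDiff]
  | succ m ih => rw [Finset.sum_range_succ, ih, chooseDiff]; simp

/-- Summation by parts: the difference at $r$ occurs in the telescoping sums for $\binom ni$ with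
$r\le i<m$, hence $m-r$ times. -/
theorem sum_chooseDiff_mul (n m : ℕ) :
    ∑ r ∈ Finset.range m, chooseDiff n r * ((m : ℤ) - r) =
      ∑ i ∈ Finset.range m, (n.choose i : ℤ) := by
  induction m with
  | zero => simp
  | succ m ih =>
    rw [Finset.sum_range_succ (fun i => (n.choose i : ℤ)), ← ih, ← sum_chooseDiff,
      Finset.sum_range_succ, Finset.sum_range_succ (fun r => chooseDiff n r), ← add_assoc,
      ← Finset.sum_add_distrib]
    congr 1
    · refine Finset.sum_congr rfl fun r _ => ?_
      push_cast
      ring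
    · push_cast
      ring

/-- Rank-nullity: the space contains the kernel of a map from $\mathbb C^X$ into a space of
dimension $\binom{2D+1}{r-1}+|X|-\binom{2D+1}{r}$. -/
theorem chooseDiff_le_finrank {D r : ℕ} (hr : r ≤ D) :
    chooseDiff (2 * D + 1) r ≤ (Module.finrank ℂ (L D r) : ℤ) := by
  -- This type is empty for $r=0$, so the truncated `r - 1` below imposes no condition then.
  let P := {x : Vertex D // x.fst.card + 1 = r}
  let Q := {x : Vertex D // x.fst.card ≠ r}
  let f : EuclideanSpace ℂ (Vertex D) →ₗ[ℂ] (P → ℂ) × (Q → ℂ) :=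
    { toFun := fun ξ => (fun x => (M D (r - 1) (r - 1) r *ᵥ ξ.ofLp) x.1, fun x => ξ x.1)
      map_add' := fun a b => by
        ext x <;> simp [Matrix.mulVec_add]
      map_smul' := fun c a => by
        ext x <;> simp [Matrix.mulVec_smul] }
  have hker : LinearMap.ker f ≤ L D r := by
    intro ξ hξ
    have h1 := fun x => congrFun (congrArg Prod.fst (LinearMap.mem_ker.1 hξ)) x
    have h2 := fun x => congrFun (congrArg Prod.snd (LinearMap.mem_ker.1 hξ)) x
    refine ⟨fun s hs => ?_, fun x hx => h2 ⟨x, hx⟩⟩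
    subst hs
    funext x
    by_cases hx : x.fst.card = s
    · exact h1 ⟨x, by rw [hx]⟩
    · rw [Matrix.mulVec, Pi.zero_apply]
      refine Finset.sum_eq_zero fun y _ => ?_
      beta_reduce
      rw [M_apply, if_neg (fun h => hx h.1), zero_mul]
  have h1 := f.finrank_range_add_finrank_ker
  have h2 := Submodule.finrank_mono hker
  have h3 := Submodule.finrank_le (LinearMap.range f)
  have h4 : Fintype.card Q = Fintype.card (Vertex D) - (2 * D + 1).choose r := by
    rw [← card_vertex_fst_eq hr]
    exact Fintype.card_subtype_compl _
  have h5 : (2 * D + 1).choose r ≤ Fintype.card (Vertex D) := by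
    rw [← card_vertex_fst_eq hr]
    exact Fintype.card_subtype_le _
  have h6 : (Fintype.card P : ℤ) =
      if r = 0 then 0 else ((2 * D + 1).choose (r - 1) : ℤ) := by
    split_ifs with h
    · subst h
      simp [P]
    · rw [← card_vertex_fst_eq (by omega), Nat.cast_inj]
      exact Fintype.card_congr (Equiv.subtypeEquivRight fun x => by omega)
  rw [finrank_euclideanSpace] at h1
  rw [Module.finrank_prod, Module.finrank_fintype_fun_eq_card,
    Module.finrank_fintype_fun_eq_card] at h3
  rw [chooseDiff, ← h6]
  omega

/-- The weighted lower bounds sum to $|X|$ and the number of columns is at most $|X|$. Since the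
weights $D+1-r$ are positive, every bound is attained. -/
theorem card_basis_and_card_tripleIndex [∀ r, DecidableEq (ι r)]
    (B : ∀ r : Fin (D + 1), OrthonormalBasis (ι r) ℂ (L D r)) :
    (∀ r : Fin (D + 1), (Fintype.card (ι r) : ℤ) = chooseDiff (2 * D + 1) r) ∧
      Fintype.card (TripleIndex D ι) = Fintype.card (Vertex D) := by
  have h1 : ∀ r : Fin (D + 1), chooseDiff (2 * D + 1) r ≤ (Fintype.card (ι r) : ℤ) := fun r => by
    rw [← Module.finrank_eq_card_basis (B r).toBasis]
    exact chooseDiff_le_finrank (Nat.lt_succ_iff.1 r.2)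
  have hle := card_tripleIndex_le B
  have hpos : ∀ r : Fin (D + 1), (0 : ℤ) < (D + 1 : ℕ) - (r : ℕ) := fun r => by
    have := r.2
    omega
  have h2 : (Fintype.card (TripleIndex D ι) : ℤ) =
      ∑ r : Fin (D + 1), (Fintype.card (ι r) : ℤ) * ((D + 1 : ℕ) - (r : ℕ)) := by
    rw [card_tripleIndex]
    push_cast
    refine Finset.sum_congr rfl fun r _ => ?_
    have := r.2
    rw [Nat.cast_sub this.le]
    push_cast
    rfl
  have h3 : (Fintype.card (Vertex D) : ℤ) =
      ∑ r : Fin (D + 1), chooseDiff (2 * D + 1) r * ((D + 1 : ℕ) - (r : ℕ)) := by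
    rw [card_vertex, Fin.sum_univ_eq_sum_range
      (fun r => chooseDiff (2 * D + 1) r * (((D + 1 : ℕ) : ℤ) - (r : ℕ))), sum_chooseDiff_mul]
    push_cast
    rfl
  have h4 : ∀ r ∈ (Finset.univ : Finset (Fin (D + 1))),
      chooseDiff (2 * D + 1) r * ((D + 1 : ℕ) - (r : ℕ)) ≤
        (Fintype.card (ι r) : ℤ) * ((D + 1 : ℕ) - (r : ℕ)) := fun r _ =>
    mul_le_mul_of_nonneg_right (h1 r) (hpos r).le
  have h5 := Finset.sum_le_sum h4
  have h6 : (Fintype.card (TripleIndex D ι) : ℤ) = Fintype.card (Vertex D) := by omega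
  refine ⟨fun r => ?_, by exact_mod_cast h6⟩
  have h7 := (Finset.sum_eq_sum_iff_of_le h4).1 (by omega) r (Finset.mem_univ r)
  exact (mul_right_cancel₀ (hpos r).ne' h7).symm

theorem U_mul_conjTranspose_U [∀ r, DecidableEq (ι r)]
    (B : ∀ r : Fin (D + 1), OrthonormalBasis (ι r) ℂ (L D r)) : U B * (U B)ᴴ = 1 :=
  (Matrix.mul_eq_one_comm_of_card_eq _ _ _
    (card_basis_and_card_tripleIndex B).2).1 (conjTranspose_U_mul_U B)

/-- Binomials increase strictly up to the middle. Consequently every block occurs at least once,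
which injectivity of the embedding requires. -/
theorem chooseDiff_pos {D r : ℕ} (hr : r ≤ D) : 0 < chooseDiff (2 * D + 1) r := by
  rw [chooseDiff]
  split_ifs with h
  · subst h
    simp
  · have : (2 * D + 1).choose (r - 1) < (2 * D + 1).choose r := by
      have h1 := Nat.choose_succ_right_eq (2 * D + 1) (r - 1)
      have h2 : 0 < (2 * D + 1).choose (r - 1) := Nat.choose_pos (by omega)
      rw [Nat.sub_add_cancel (by omega)] at h1
      by_contra! h3
      have h4 : r < 2 * D + 1 - (r - 1) := by omega
      have := Nat.mul_lt_mul_of_le_of_lt h3 h4 h2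
      omega
    omega

theorem nonempty_basis_index [∀ r, DecidableEq (ι r)]
    (B : ∀ r : Fin (D + 1), OrthonormalBasis (ι r) ℂ (L D r)) (r : Fin (D + 1)) : Nonempty (ι r) := by
  rw [← Fintype.card_pos_iff]
  have h1 := (card_basis_and_card_tripleIndex B).1 r
  have h2 := chooseDiff_pos (Nat.lt_succ_iff.1 r.2)
  omega

end Basis

end FoldedCube

/-! ### The block algebra inside the full matrix algebra -/

namespace FoldedCube

/-- The direct sum of the full matrix algebras on the index sets `N D r`. -/
abbrev BlockAlgebra (D : ℕ) : Type :=
  (r : Fin (D + 1)) → Matrix (N D r) (N D r) ℂ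

section Embedding

variable {D : ℕ} {ι : Fin (D + 1) → Type*} [∀ r, Fintype (ι r)] [∀ r, DecidableEq (ι r)]

/-- The block diagonal matrix in which the `r`-th block is repeated once for each element of
`ι r`. -/
noncomputable def repeatedBlocks (ι : Fin (D + 1) → Type*) [∀ r, Fintype (ι r)] [∀ r, DecidableEq (ι r)] :
    BlockAlgebra D →ₐ[ℂ] Matrix (TripleIndex D ι) (TripleIndex D ι) ℂ where
  toFun Z := Matrix.blockDiagonal' fun r => (1 : Matrix (ι r) (ι r) ℂ) ⊗ₖ Z r
  map_one' := by
    simp only [Pi.one_apply, Matrix.one_kronecker_one]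
    exact Matrix.blockDiagonal'_one
  map_mul' Y Z := by
    rw [← Matrix.blockDiagonal'_mul]
    simp only [← Matrix.mul_kronecker_mul, one_mul, Pi.mul_apply]
  map_zero' := by
    simp only [Pi.zero_apply, Matrix.kronecker_zero]
    exact Matrix.blockDiagonal'_zero
  map_add' Y Z := by
    rw [← Matrix.blockDiagonal'_add]
    simp only [Matrix.kronecker_add, Pi.add_apply]
    rfl
  commutes' c := by
    rw [Algebra.algebraMap_eq_smul_one, Algebra.algebraMap_eq_smul_one]
    simp only [Pi.smul_apply, Pi.one_apply, Matrix.kronecker_smul, Matrix.one_kronecker_one]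
    exact (Matrix.blockDiagonal'_smul c _).trans (congrArg (c • ·) Matrix.blockDiagonal'_one)

theorem repeatedBlocks_apply (Z : BlockAlgebra D) :
    repeatedBlocks ι Z = Matrix.blockDiagonal' fun r => (1 : Matrix (ι r) (ι r) ℂ) ⊗ₖ Z r := rfl

theorem repeatedBlocks_conjTranspose (Z : BlockAlgebra D) :
    (repeatedBlocks ι Z)ᴴ = repeatedBlocks ι (fun r => (Z r)ᴴ) := by
  rw [repeatedBlocks_apply, repeatedBlocks_apply, Matrix.blockDiagonal'_conjTranspose]
  simp only [Matrix.conjTranspose_kronecker, Matrix.conjTranspose_one]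

theorem repeatedBlocks_injective [∀ r, Nonempty (ι r)] :
    Function.Injective (repeatedBlocks (D := D) ι) := by
  intro Y Z h
  rw [repeatedBlocks_apply, repeatedBlocks_apply] at h
  have h1 := Matrix.blockDiagonal'_injective h
  funext r
  ext a b
  obtain ⟨k⟩ := (inferInstance : Nonempty (ι r))
  have h2 := congrFun (congrFun (congrFun h1 r) (k, a)) (k, b)
  simpa [Matrix.kronecker_apply] using h2

variable (B : ∀ r : Fin (D + 1), OrthonormalBasis (ι r) ℂ (L D r))

/-- Conjugation by `U` of the block diagonal matrices with repeated blocks. -/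
noncomputable def blockEmbedding : BlockAlgebra D →ₐ[ℂ] Matrix (Vertex D) (Vertex D) ℂ where
  toFun Z := U B * repeatedBlocks ι Z * (U B)ᴴ
  map_one' := by rw [map_one, Matrix.mul_one, U_mul_conjTranspose_U]
  map_mul' Y Z := by
    rw [map_mul]
    simp only [Matrix.mul_assoc]
    rw [← Matrix.mul_assoc (U B)ᴴ (U B), conjTranspose_U_mul_U, Matrix.one_mul]
  map_zero' := by rw [map_zero, Matrix.mul_zero, Matrix.zero_mul]
  map_add' Y Z := by rw [map_add, Matrix.mul_add, Matrix.add_mul]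
  commutes' c := by
    rw [AlgHom.commutes, Algebra.algebraMap_eq_smul_one, Algebra.algebraMap_eq_smul_one,
      Matrix.mul_smul, Matrix.smul_mul, Matrix.mul_one, U_mul_conjTranspose_U]

theorem blockEmbedding_apply (Z : BlockAlgebra D) :
    blockEmbedding B Z = U B * repeatedBlocks ι Z * (U B)ᴴ := rfl

theorem conjTranspose_U_mul_blockEmbedding_mul_U (Z : BlockAlgebra D) :
    (U B)ᴴ * blockEmbedding B Z * U B = repeatedBlocks ι Z := by
  rw [blockEmbedding_apply]
  simp only [Matrix.mul_assoc]
  rw [conjTranspose_U_mul_U, Matrix.mul_one, ← Matrix.mul_assoc, conjTranspose_U_mul_U,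
    Matrix.one_mul]

theorem blockEmbedding_injective : Function.Injective (blockEmbedding B) := by
  intro Y Z h
  have := nonempty_basis_index B
  refine repeatedBlocks_injective (ι := ι) ?_
  rw [← conjTranspose_U_mul_blockEmbedding_mul_U B Y, h, conjTranspose_U_mul_blockEmbedding_mul_U]

theorem blockEmbedding_conjTranspose (Z : BlockAlgebra D) :
    (blockEmbedding B Z)ᴴ = blockEmbedding B (fun r => (Z r)ᴴ) := by
  rw [blockEmbedding_apply, blockEmbedding_apply, ← repeatedBlocks_conjTranspose,
    Matrix.conjTranspose_mul, Matrix.conjTranspose_mul, Matrix.conjTranspose_conjTranspose,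
    Matrix.mul_assoc]

theorem U_mul_repeatedBlocks_apply (Z : BlockAlgebra D) (x : Vertex D) (r : Fin (D + 1))
    (k : ι r) (b : N D r) :
    (U B * repeatedBlocks ι Z) x ⟨r, k, b⟩ = ∑ a : N D r, Z r a b * U B x ⟨r, k, a⟩ := by
  rw [Matrix.mul_apply, Fintype.sum_sigma, Finset.sum_eq_single r, Fintype.sum_prod_type,
    Finset.sum_eq_single k]
  · refine Finset.sum_congr rfl fun a _ => ?_
    rw [repeatedBlocks_apply, Matrix.blockDiagonal'_apply_eq, Matrix.kronecker_apply,
      Matrix.one_apply_eq, one_mul, mul_comm]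
  · intro l _ hl
    refine Finset.sum_eq_zero fun a _ => ?_
    rw [repeatedBlocks_apply, Matrix.blockDiagonal'_apply_eq, Matrix.kronecker_apply,
      Matrix.one_apply_ne hl, zero_mul, mul_zero]
  · simp
  · intro r' _ hr
    refine Finset.sum_eq_zero fun a _ => ?_
    rw [repeatedBlocks_apply, Matrix.blockDiagonal'_apply_ne _ _ _ hr, mul_zero]
  · simp

/-- The hypothesis gives $YU'=U'\tilde Z$, with $\tilde Z$ the repeated blocks of $Z$, and unitarity
moves $U'$ across. Arbitrary $\xi$ is allowed since the identities fed in hold for the matrices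
themselves. -/
theorem eq_blockEmbedding_of_mulVec_u {Y : Matrix (Vertex D) (Vertex D) ℂ} {Z : BlockAlgebra D}
    (h : ∀ (r : Fin (D + 1)) (ξ : EuclideanSpace ℂ (Vertex D)) (b : N D r),
      Y *ᵥ u D r ξ b = ∑ a : N D r, Z r a b • u D r ξ a) :
    Y = blockEmbedding B Z := by
  have h1 : Y * U B = U B * repeatedBlocks ι Z := by
    ext x ⟨r, k, b⟩
    rw [U_mul_repeatedBlocks_apply]
    refine (congrFun (h r (B r k) b) x).trans ?_
    rw [Finset.sum_apply]
    rfl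
  rw [blockEmbedding_apply, ← h1, Matrix.mul_assoc, U_mul_conjTranspose_U, Matrix.mul_one]

/-- The nonzero entry of the `r`-th block of `M D s k s`. -/
noncomputable def upEntry (D r s k : ℕ) : ℂ :=
  (k - r).choose (s - r) * normFactor D r s * (normFactor D r k)⁻¹

theorem upEntry_self_ne_zero {D s k : ℕ} (hk : k ≤ D) (hs : s ≤ k) : upEntry D s s k ≠ 0 := by
  rw [upEntry, Nat.sub_self, Nat.choose_zero_right, Nat.cast_one, one_mul]
  exact mul_ne_zero (normFactor_ne_zero (hs.trans hk) le_rfl)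
    (inv_ne_zero (normFactor_ne_zero hk hs))

/-- The blocks of `M D s k s`. -/
noncomputable def upBlock (D s k : ℕ) : BlockAlgebra D := fun r =>
  Matrix.of fun a b => if (a : ℕ) = k ∧ (b : ℕ) = s then upEntry D r s k else 0

/-- By the up·up rule $u_{r,\xi,s}$ goes to a multiple of $u_{r,\xi,k}$, and other levels go to $0$.
The entry is the binomial coefficient corrected by the ratio of normalizations. -/
theorem M_up_eq_blockEmbedding {s k : ℕ} (hk : k ≤ D) (hs : s ≤ k) :
    M D s k s = blockEmbedding B (upBlock D s k) := by
  refine eq_blockEmbedding_of_mulVec_u B fun r ξ b => ?_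
  rw [u_eq, Matrix.mulVec_smul, Matrix.mulVec_mulVec]
  have hb := N_prop b
  by_cases hbs : (b : ℕ) = s
  · have hrs : (r : ℕ) ≤ s := by omega
    rw [hbs, M_up_mul_M_up D k hrs, Finset.sum_eq_single
      (⟨k, Finset.mem_Icc.2 ⟨hrs.trans hs, hk⟩⟩ : N D r), upBlock, Matrix.of_apply, if_pos ⟨rfl, hbs⟩,
      u_eq, upEntry, smul_smul, Matrix.smul_mulVec, smul_smul,
      inv_mul_cancel_right₀ (normFactor_ne_zero hk (hrs.trans hs)), mul_comm]
    · intro a _ ha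
      rw [upBlock, Matrix.of_apply, if_neg fun h => ha (Subtype.ext h.1), zero_smul]
    · simp
  · rw [M_mul_M_of_ne fun h => hbs h.symm, Matrix.zero_mulVec, smul_zero]
    refine (Finset.sum_eq_zero fun a _ => ?_).symm
    rw [upBlock, Matrix.of_apply, if_neg fun h => hbs h.2, zero_smul]

theorem M_down_eq_blockEmbedding {s k : ℕ} (hk : k ≤ D) (hs : s ≤ k) :
    M D s s k = blockEmbedding B (fun r => (upBlock D s k r)ᴴ) := by
  rw [← M_conjTranspose, M_up_eq_blockEmbedding B hk hs, blockEmbedding_conjTranspose]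

/-- The up·down product through level $t$ equals $\sum_{s\ge t}\binom st M^s_{i,j}$. This system is
unitriangular, so downward induction on $t$ isolates $M^t_{i,j}$. -/
theorem M_mem_range_blockEmbedding {t i j : ℕ} (hi : i ≤ D) (hj : j ≤ D) :
    M D t i j ∈ (blockEmbedding B).range := by
  induction h : D + 1 - t using Nat.strong_induction_on generalizing t with
  | _ m ih =>
  by_cases hti : i < t
  · rw [M_eq_zero_left hti]
    exact zero_mem _
  by_cases htj : j < t
  · rw [M_eq_zero_right htj]
    exact zero_mem _
  have key : M D t i j = M D t i t * M D t t j -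
      ∑ s ∈ Finset.Icc (t + 1) D, (s.choose t : ℂ) • M D s i j := by
    ext x z
    rw [Matrix.sub_apply, Matrix.sum_apply, M_up_mul_M_down_apply]
    simp only [Matrix.smul_apply, M_apply, smul_eq_mul]
    by_cases hxz : x.fst.card = i ∧ z.fst.card = j
    · obtain ⟨hx, hz⟩ := hxz
      simp only [hx, hz, true_and, and_self, if_true, mul_ite, mul_one, mul_zero]
      rw [Finset.sum_ite_eq]
      have hle : (x.fst ∩ z.fst).card ≤ D :=
        (Finset.card_le_card Finset.inter_subset_left).trans (card_fst_le x)
      rcases lt_trichotomy (x.fst ∩ z.fst).card t with hc | hc | hc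
      · rw [if_neg hc.ne, if_neg (by rw [Finset.mem_Icc]; omega), Nat.choose_eq_zero_of_lt hc]
        simp
      · rw [if_pos hc, if_neg (by rw [Finset.mem_Icc]; omega), hc]
        simp
      · rw [if_neg hc.ne', if_pos (by rw [Finset.mem_Icc]; omega), sub_self]
    · rw [if_neg hxz, if_neg (by tauto), Finset.sum_eq_zero, sub_zero]
      intro s _
      rw [if_neg (by tauto), mul_zero]
  rw [key]
  refine sub_mem (mul_mem ?_ ?_) (sum_mem fun s hs => ?_)
  · exact ⟨_, (M_up_eq_blockEmbedding B hi (not_lt.1 hti)).symm⟩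
  · exact ⟨_, (M_down_eq_blockEmbedding B hj (not_lt.1 htj)).symm⟩
  · rw [Finset.mem_Icc] at hs
    exact Subalgebra.smul_mem _ (ih _ (by omega) rfl) _

/-- A matrix whose entries depend only on the sizes of the two sets and of their intersection is
block diagonalized by `U`. -/
theorem mem_range_blockEmbedding_of_card (g : ℕ → ℕ → ℕ → ℂ)
    {Y : Matrix (Vertex D) (Vertex D) ℂ}
    (hY : ∀ x y, Y x y = g x.fst.card y.fst.card (x.fst ∩ y.fst).card) :
    Y ∈ (blockEmbedding B).range := by
  have key : Y = ∑ i ∈ Finset.range (D + 1), ∑ j ∈ Finset.range (D + 1),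
      ∑ t ∈ Finset.range (D + 1), g i j t • M D t i j := by
    ext x y
    have hle : (x.fst ∩ y.fst).card ≤ D :=
      (Finset.card_le_card Finset.inter_subset_left).trans (card_fst_le x)
    simp only [Matrix.sum_apply, Matrix.smul_apply, M_apply, smul_eq_mul]
    rw [Finset.sum_eq_single_of_mem x.fst.card
        (Finset.mem_range.2 (Nat.lt_succ_iff.2 (card_fst_le x))),
      Finset.sum_eq_single_of_mem y.fst.card
        (Finset.mem_range.2 (Nat.lt_succ_iff.2 (card_fst_le y))),
      Finset.sum_eq_single_of_mem (x.fst ∩ y.fst).card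
        (Finset.mem_range.2 (Nat.lt_succ_iff.2 hle)), hY, if_pos ⟨rfl, rfl, rfl⟩, mul_one]
    · exact fun t _ ht => by rw [if_neg fun h => ht h.2.2.symm, mul_zero]
    · exact fun j _ hj => Finset.sum_eq_zero fun t _ => by
        rw [if_neg fun h => hj h.2.1.symm, mul_zero]
    · exact fun i _ hi => Finset.sum_eq_zero fun j _ => Finset.sum_eq_zero fun t _ => by
        rw [if_neg fun h => hi h.1.symm, mul_zero]
  rw [key]
  refine sum_mem fun i hi => sum_mem fun j hj => sum_mem fun t _ => Subalgebra.smul_mem _ ?_ _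
  exact M_mem_range_blockEmbedding B (Nat.lt_succ_iff.1 (Finset.mem_range.1 hi))
    (Nat.lt_succ_iff.1 (Finset.mem_range.1 hj))

/-- The element of the block algebra with a single nonzero entry `1` in the `r`-th block. -/
noncomputable def blockUnit (D : ℕ) (r : Fin (D + 1)) (a b : N D r) : BlockAlgebra D :=
  Pi.single r (Matrix.single a b 1)

/-! ### Matrix units from inclusion matrices -/

theorem upBlock_mul_conjTranspose_apply (s : Fin (D + 1)) (a b : N D s) (r : Fin (D + 1))
    (c d : N D r) :
    (upBlock D s a r * (upBlock D s b r)ᴴ) c d =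
      if r ≤ s ∧ (c : ℕ) = a ∧ (d : ℕ) = b then upEntry D r s a * star (upEntry D r s b)
        else 0 := by
  rw [Matrix.mul_apply]
  simp only [Matrix.conjTranspose_apply, upBlock, Matrix.of_apply]
  by_cases hrs : r ≤ s
  · rw [Finset.sum_eq_single (⟨s, Finset.mem_Icc.2 ⟨hrs, Nat.lt_succ_iff.1 s.2⟩⟩ : N D r)]
    · by_cases hc : (c : ℕ) = a <;> by_cases hd : (d : ℕ) = b <;> simp [hc, hd, hrs]
    · intro e _ he
      rw [if_neg fun h => he (Subtype.ext h.2), zero_mul]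
    · simp
  · rw [if_neg fun h => hrs h.1]
    refine Finset.sum_eq_zero fun e _ => ?_
    rw [if_neg, zero_mul]
    rintro ⟨_, h⟩
    exact hrs (Fin.le_def.2 (h ▸ (N_prop e).1))

/-- Passing through level $s$ meets only the blocks $r\le s$, since $s\in N_r$ is needed. The
product is thus a unit of block $s$, up to a scalar, plus units of earlier blocks, a triangular
system for induction on $s$. -/
theorem upBlock_mul_conjTranspose_eq (s : Fin (D + 1)) (a b : N D s) :
    (upBlock D s a * fun r => (upBlock D s b r)ᴴ) =
      (upEntry D s s a * star (upEntry D s s b)) • blockUnit D s a b +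
      ∑ r : Fin (D + 1), if h : r < s then
        (upEntry D r s a * star (upEntry D r s b)) • blockUnit D r
          ⟨a, Finset.mem_Icc.2 ⟨(Fin.le_def.1 h.le).trans (N_prop a).1, (N_prop a).2⟩⟩
          ⟨b, Finset.mem_Icc.2 ⟨(Fin.le_def.1 h.le).trans (N_prop b).1, (N_prop b).2⟩⟩
        else 0 := by
  funext q
  ext c d
  rw [Pi.mul_apply, upBlock_mul_conjTranspose_apply, Pi.add_apply, Matrix.add_apply,
    Finset.sum_apply, Matrix.sum_apply, Finset.sum_eq_single q]
  · rcases lt_trichotomy q s with hq | hq | hq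
    · rw [dif_pos hq, Pi.smul_apply, blockUnit, Pi.single_eq_of_ne hq.ne]
      simp only [blockUnit, Pi.smul_apply, Pi.single_eq_same, Matrix.smul_apply, Matrix.single_apply,
        hq.le, true_and, Matrix.zero_apply, zero_add, smul_eq_mul, mul_ite, mul_one,
        mul_zero]
      refine if_congr ?_ rfl rfl
      rw [Subtype.ext_iff, Subtype.ext_iff]
      simp only [eq_comm]
    · subst hq
      rw [dif_neg (lt_irrefl _)]
      simp only [blockUnit, Pi.smul_apply, Pi.single_eq_same, Matrix.smul_apply, Matrix.single_apply,
        le_rfl, true_and, Pi.zero_apply, Matrix.zero_apply, add_zero, smul_eq_mul, mul_ite, mul_one,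
        mul_zero]
      refine if_congr ?_ rfl rfl
      rw [Subtype.ext_iff, Subtype.ext_iff]
      simp only [eq_comm]
    · rw [if_neg fun h => absurd h.1 (not_le.2 hq), dif_neg hq.not_gt, Pi.smul_apply, blockUnit,
        Pi.single_eq_of_ne hq.ne']
      simp
  · intro r _ hr
    split_ifs
    · rw [Pi.smul_apply, blockUnit, Pi.single_eq_of_ne hr.symm]
      simp
    · rfl
  · simp

/-- A subalgebra containing the inclusion matrices and their transposes contains all matrices that
`U` puts in block diagonal form with repeated blocks. -/
theorem range_blockEmbedding_le {A : Subalgebra ℂ (Matrix (Vertex D) (Vertex D) ℂ)}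
    (hup : ∀ s i, s ≤ i → i ≤ D → M D s i s ∈ A) (hdown : ∀ s i, s ≤ i → i ≤ D → M D s s i ∈ A) :
    (blockEmbedding B).range ≤ A := by
  have hunit : ∀ (m : ℕ) (s : Fin (D + 1)), (s : ℕ) = m → ∀ a b : N D s,
      blockEmbedding B (blockUnit D s a b) ∈ A := by
    intro m
    induction m using Nat.strong_induction_on with
    | _ m ih =>
    rintro s rfl a b
    have ha := N_prop a
    have hb := N_prop b
    have h := congrArg (blockEmbedding B) (upBlock_mul_conjTranspose_eq s a b)
    rw [map_mul, map_add, map_smul, map_sum, ← M_up_eq_blockEmbedding B ha.2 ha.1,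
      ← M_down_eq_blockEmbedding B hb.2 hb.1] at h
    have hne : upEntry D s s a * star (upEntry D s s b) ≠ 0 :=
      mul_ne_zero (upEntry_self_ne_zero ha.2 ha.1)
        (star_ne_zero.2 (upEntry_self_ne_zero hb.2 hb.1))
    rw [← inv_smul_smul₀ hne (blockEmbedding B _), eq_sub_of_add_eq h.symm]
    refine Subalgebra.smul_mem _ (sub_mem (mul_mem (hup _ _ ha.1 ha.2) (hdown _ _ hb.1 hb.2))
      (sum_mem fun r _ => ?_)) _
    split_ifs with hrs
    · rw [map_smul]
      exact Subalgebra.smul_mem _ (ih r hrs r rfl _ _) _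
    · rw [map_zero]
      exact zero_mem _
  rintro _ ⟨Z, rfl⟩
  have hZ : Z = ∑ r : Fin (D + 1), ∑ a : N D r, ∑ b : N D r, Z r a b • blockUnit D r a b := by
    conv_lhs => rw [← Finset.univ_sum_single Z]
    refine Finset.sum_congr rfl fun r _ => ?_
    -- Viewing the insertion of a block as a linear map lets sums and scalars pass through it.
    change LinearMap.single ℂ (fun r : Fin (D + 1) => Matrix (N D r) (N D r) ℂ) r (Z r) =
      ∑ a, ∑ b, Z r a b • LinearMap.single ℂ (fun r : Fin (D + 1) => Matrix (N D r) (N D r) ℂ) r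
        (Matrix.single a b 1)
    simp only [← map_smul, ← map_sum, Matrix.smul_single, smul_eq_mul, mul_one]
    rw [← Matrix.matrix_eq_sum_single]
  change blockEmbedding B Z ∈ A
  rw [hZ, map_sum]
  simp only [map_sum, map_smul]
  exact sum_mem fun r _ => sum_mem fun a _ => sum_mem fun b _ =>
    Subalgebra.smul_mem _ (hunit r r rfl a b) _

end Embedding

end FoldedCube

/-! ### Path-length distance in the folded cube -/

theorem Finset.card_symmDiff_add_two_mul_card_inter {α : Type*} [DecidableEq α]
    (s t : Finset α) : (symmDiff s t).card + 2 * (s ∩ t).card = s.card + t.card := by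
  have h1 := Finset.card_sdiff_add_card_inter s t
  have h2 := Finset.card_sdiff_add_card_inter t s
  have h3 : (symmDiff s t).card = (s \ t).card + (t \ s).card :=
    Finset.card_union_of_disjoint disjoint_sdiff_sdiff
  rw [Finset.inter_comm] at h2
  omega

theorem Finset.symmDiff_compl_right {α : Type*} [Fintype α] [DecidableEq α] (s t : Finset α) :
    symmDiff s tᶜ = (symmDiff s t)ᶜ := by
  ext a
  simp only [Finset.mem_symmDiff, Finset.mem_compl]
  tauto

namespace FoldedCube

theorem minDist_eq {D : ℕ} (x y : Vertex D) :
    minDist x y = min (symmDiff x.fst y.fst).card (2 * D + 1 - (symmDiff x.fst y.fst).card) := by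
  have h1 : symmDiff x.fst y.snd = (symmDiff x.fst y.fst)ᶜ :=
    Finset.symmDiff_compl_right _ _
  have h2 : symmDiff x.snd y.fst = (symmDiff x.fst y.fst)ᶜ := by
    rw [symmDiff_comm, symmDiff_comm x.fst]
    exact Finset.symmDiff_compl_right _ _
  have h3 : symmDiff x.snd y.snd = symmDiff x.fst y.fst := compl_symmDiff_compl _ _
  rw [minDist, h1, h2, h3, Finset.card_compl, Fintype.card_fin]
  omega

theorem minDist_triangle {D : ℕ} (x y z : Vertex D) :
    minDist x z ≤ minDist x y + minDist y z := by
  have h : symmDiff x.fst z.fst = symmDiff (symmDiff x.fst y.fst) (symmDiff y.fst z.fst) := by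
    rw [symmDiff_assoc, symmDiff_symmDiff_cancel_left]
  rw [minDist_eq, minDist_eq, minDist_eq, h]
  generalize symmDiff x.fst y.fst = s
  generalize symmDiff y.fst z.fst = t
  have h1 := Finset.card_symmDiff_add_two_mul_card_inter s t
  have h2 := Finset.card_union_add_card_inter s t
  have h3 := (s ∪ t).card_le_univ
  have h4 := Finset.card_le_card (Finset.inter_subset_left (s₁ := s) (s₂ := t))
  have h5 := Finset.card_le_card (Finset.inter_subset_right (s₁ := s) (s₂ := t))
  rw [Fintype.card_fin] at h3
  omega

theorem minDist_le_length {D : ℕ} {x y : Vertex D} (p : (graph D).Walk x y) :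
    minDist x y ≤ p.length := by
  induction p with
  | nil => rw [minDist_self]; exact Nat.zero_le _
  | @cons a b c hab q ih =>
    have h1 : minDist a b = 1 := hab
    have h2 := minDist_triangle a b c
    rw [SimpleGraph.Walk.length_cons]
    omega

/-- The symmetric difference cannot be all of $S$, because $|x_1|+|y_1|\le 2D$. -/
theorem minDist_eq_zero_iff {D : ℕ} {x y : Vertex D} : minDist x y = 0 ↔ x = y := by
  refine ⟨fun h => ?_, fun h => h ▸ minDist_self x⟩
  rw [minDist_eq] at h
  have h1 := Finset.card_symmDiff_add_two_mul_card_inter x.fst y.fst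
  have h2 := card_fst_le x
  have h3 := card_fst_le y
  have h4 : (symmDiff x.fst y.fst).card = 0 := by omega
  rw [Finset.card_eq_zero] at h4
  exact Subtype.ext (symmDiff_eq_bot.1 h4)

/-- The vertex with members `s` and its complement. -/
def ofFinset (D : ℕ) (s : Finset (Fin (2 * D + 1))) : Vertex D :=
  if h : s.card < sᶜ.card then ⟨s, h⟩ else ⟨sᶜ, by
    rw [card_lt_card_compl_iff, not_le] at h
    rw [card_lt_card_compl_iff, Finset.card_compl, Fintype.card_fin]
    omega⟩

theorem minDist_ofFinset {D : ℕ} (x : Vertex D) (s : Finset (Fin (2 * D + 1))) :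
    minDist x (ofFinset D s) =
      min (symmDiff x.fst s).card (2 * D + 1 - (symmDiff x.fst s).card) := by
  rw [minDist_eq, ofFinset]
  split_ifs with h
  · rfl
  · have h1 : symmDiff x.fst sᶜ = (symmDiff x.fst s)ᶜ :=
    Finset.symmDiff_compl_right _ _
    have h2 := (symmDiff x.fst s).card_le_univ
    rw [Fintype.card_fin] at h2
    change min (symmDiff x.fst sᶜ).card (2 * D + 1 - (symmDiff x.fst sᶜ).card) = _
    rw [h1, Finset.card_compl, Fintype.card_fin]
    omega

/-- Toggle one element of $y_1$: inside $x_1\triangle y_1$ if that set has at most $D$ elements,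
outside it otherwise. Either way the smaller of the set and its complement loses an element. -/
theorem exists_adj_minDist {D k : ℕ} {x y : Vertex D} (h : minDist x y = k + 1) :
    ∃ z, (graph D).Adj y z ∧ minDist x z = k := by
  have h0 := (symmDiff x.fst y.fst).card_le_univ
  rw [Fintype.card_fin] at h0
  rw [minDist_eq] at h
  have step : ∀ a, (graph D).Adj y (ofFinset D (symmDiff y.fst {a})) ∧
      minDist x (ofFinset D (symmDiff y.fst {a})) =
        min (symmDiff (symmDiff x.fst y.fst) {a}).card
          (2 * D + 1 - (symmDiff (symmDiff x.fst y.fst) {a}).card) := fun a => by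
    refine ⟨?_, by rw [minDist_ofFinset, symmDiff_assoc]⟩
    change minDist _ _ = 1
    rw [minDist_ofFinset, symmDiff_symmDiff_cancel_left, Finset.card_singleton]
    omega
  by_cases hc : (symmDiff x.fst y.fst).card ≤ D
  · obtain ⟨a, ha⟩ : (symmDiff x.fst y.fst).Nonempty := Finset.card_pos.1 (by omega)
    refine ⟨_, (step a).1, (step a).2.trans ?_⟩
    have h1 := Finset.card_symmDiff_add_two_mul_card_inter (symmDiff x.fst y.fst) {a}
    rw [Finset.inter_singleton_of_mem ha, Finset.card_singleton] at h1
    omega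
  · obtain ⟨a, ha⟩ : ((symmDiff x.fst y.fst)ᶜ).Nonempty := by
      rw [← Finset.card_pos, Finset.card_compl, Fintype.card_fin]
      omega
    rw [Finset.mem_compl] at ha
    refine ⟨_, (step a).1, (step a).2.trans ?_⟩
    have h1 := Finset.card_symmDiff_add_two_mul_card_inter (symmDiff x.fst y.fst) {a}
    rw [Finset.inter_singleton_of_notMem ha, Finset.card_singleton, Finset.card_empty] at h1
    omega

theorem exists_walk_length_eq_minDist {D : ℕ} (x : Vertex D) (k : ℕ) :
    ∀ y, minDist x y = k → ∃ p : (graph D).Walk y x, p.length = k := by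
  induction k with
  | zero =>
    intro y h
    obtain rfl := minDist_eq_zero_iff.1 h
    exact ⟨.nil, rfl⟩
  | succ k ih =>
    intro y h
    obtain ⟨z, hz, hk⟩ := exists_adj_minDist h
    obtain ⟨p, hp⟩ := ih z hk
    exact ⟨.cons hz p, by rw [SimpleGraph.Walk.length_cons, hp]⟩

/-- Descending one step at a time gives a walk of this length; the triangle inequality for `minDist`
along any walk shows that none is shorter. -/
theorem dist_eq_minDist {D : ℕ} (x y : Vertex D) : (graph D).dist x y = minDist x y := by
  obtain ⟨p, hp⟩ := exists_walk_length_eq_minDist x _ y rfl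
  rw [SimpleGraph.dist_comm]
  refine le_antisymm ((SimpleGraph.dist_le p).trans hp.le) ?_
  obtain ⟨q, hq⟩ := p.reachable.exists_walk_length_eq_dist
  rw [← hq, minDist_comm]
  exact minDist_le_length q

theorem dist_zero {D : ℕ} (x : Vertex D) : (graph D).dist (zero D) x = x.fst.card := by
  have h : symmDiff (zero D).fst x.fst = x.fst := bot_symmDiff _
  rw [dist_eq_minDist, minDist_eq, h]
  have := card_fst_le x
  omega

/-! ### Inclusion matrices in the Terwilliger algebra -/

theorem dualIdempotent_eq (D i : ℕ) : dualIdempotent (graph D) (zero D) i = M D i i i := by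
  ext x y
  rw [dualIdempotent, Matrix.diagonal_apply, dist_zero, M_up_apply, ← ite_and]
  refine if_congr ⟨?_, ?_⟩ rfl rfl
  · rintro ⟨rfl, h⟩
    exact ⟨h, h, subset_rfl⟩
  · rintro ⟨h1, h2, h3⟩
    exact ⟨Subtype.ext (Finset.eq_of_subset_of_card_le h3 (h1.trans h2.symm).le).symm, h1⟩

theorem distanceMatrix_apply (D k : ℕ) (x y : Vertex D) :
    distanceMatrix (graph D) k x y =
      if min (x.fst.card + y.fst.card - 2 * (x.fst ∩ y.fst).card)
        (2 * D + 1 - (x.fst.card + y.fst.card - 2 * (x.fst ∩ y.fst).card)) = k then 1 else 0 := by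
  rw [distanceMatrix, Matrix.of_apply, dist_eq_minDist, minDist_eq,
    ← Finset.card_symmDiff_add_two_mul_card_inter, Nat.add_sub_cancel]

theorem diag_mul_mul_diag_apply {D : ℕ} (Y : Matrix (Vertex D) (Vertex D) ℂ) (i j : ℕ)
    (x y : Vertex D) :
    (dualIdempotent (graph D) (zero D) i * Y * dualIdempotent (graph D) (zero D) j) x y =
      if x.fst.card = i ∧ y.fst.card = j then Y x y else 0 := by
  rw [dualIdempotent, dualIdempotent, Matrix.mul_diagonal, Matrix.diagonal_mul, dist_zero,
    dist_zero]
  by_cases h1 : x.fst.card = i <;> by_cases h2 : y.fst.card = j <;> simp [h1, h2]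

/-- For sizes $i+1$ and $i$ the complement of the symmetric difference has at least $2D-2i\ge 2$
elements, so adjacency can only mean inclusion. -/
theorem M_succ_eq {D i : ℕ} (hi : i + 1 ≤ D) :
    M D i (i + 1) i = dualIdempotent (graph D) (zero D) (i + 1) * distanceMatrix (graph D) 1 *
      dualIdempotent (graph D) (zero D) i := by
  ext x y
  rw [diag_mul_mul_diag_apply, M_apply, distanceMatrix_apply, ← ite_and]
  refine if_congr ⟨?_, ?_⟩ rfl rfl
  · rintro ⟨h1, h2, h3⟩
    rw [h1, h2, h3]
    refine ⟨⟨rfl, rfl⟩, ?_⟩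
    omega
  · rintro ⟨⟨h1, h2⟩, h3⟩
    rw [h1, h2] at h3
    have := Finset.card_le_card (Finset.inter_subset_right (s₁ := x.fst) (s₂ := y.fst))
    exact ⟨h1, h2, by omega⟩

theorem M_succ_transpose_eq {D i : ℕ} (hi : i + 1 ≤ D) :
    M D i i (i + 1) = dualIdempotent (graph D) (zero D) i * distanceMatrix (graph D) 1 *
      dualIdempotent (graph D) (zero D) (i + 1) := by
  have h : (distanceMatrix (graph D) 1)ᵀ = distanceMatrix (graph D) 1 := by
    ext x y
    rw [Matrix.transpose_apply, distanceMatrix, Matrix.of_apply, Matrix.of_apply,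
      SimpleGraph.dist_comm]
  rw [← M_transpose, M_succ_eq hi, Matrix.transpose_mul, Matrix.transpose_mul, h,
    dualIdempotent_eq, dualIdempotent_eq, M_transpose, M_transpose, Matrix.mul_assoc]

theorem distanceMatrix_mem_T (D k : ℕ) : distanceMatrix (graph D) k ∈ T D :=
  Algebra.subset_adjoin (Or.inl (Submodule.subset_span ⟨k, rfl⟩))

theorem dualIdempotent_mem_T (D k : ℕ) : dualIdempotent (graph D) (zero D) k ∈ T D :=
  Algebra.subset_adjoin (Or.inr (Submodule.subset_span ⟨k, rfl⟩))

/-- Climbing one level at a time multiplies by the nonzero number $\binom{i+1-s}{i-s}$, which is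
divided out. -/
theorem M_up_mem_T {D s i : ℕ} (hs : s ≤ i) (hi : i ≤ D) : M D s i s ∈ T D := by
  induction i, hs using Nat.le_induction with
  | base => exact dualIdempotent_eq D s ▸ dualIdempotent_mem_T D s
  | succ i hs ih =>
    have h := M_up_mul_M_up D (i + 1) hs
    have hne : (((i + 1 - s).choose (i - s) : ℕ) : ℂ) ≠ 0 := by
      exact_mod_cast (Nat.choose_pos (by omega)).ne'
    rw [← inv_smul_smul₀ hne (M D s (i + 1) s), ← h]
    refine Subalgebra.smul_mem _ (mul_mem ?_ (ih (by omega))) _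
    rw [M_succ_eq hi]
    exact mul_mem (mul_mem (dualIdempotent_mem_T D _) (distanceMatrix_mem_T D 1))
      (dualIdempotent_mem_T D _)

theorem M_down_mem_T {D s i : ℕ} (hs : s ≤ i) (hi : i ≤ D) : M D s s i ∈ T D := by
  induction i, hs using Nat.le_induction with
  | base => exact dualIdempotent_eq D s ▸ dualIdempotent_mem_T D s
  | succ i hs ih =>
    have h := M_down_mul_M_down D (i + 1) hs
    have hne : (((i + 1 - s).choose (i - s) : ℕ) : ℂ) ≠ 0 := by
      exact_mod_cast (Nat.choose_pos (by omega)).ne'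
    rw [← inv_smul_smul₀ hne (M D s s (i + 1)), ← h]
    refine Subalgebra.smul_mem _ (mul_mem (ih (by omega)) ?_) _
    rw [M_succ_transpose_eq hi]
    exact mul_mem (mul_mem (dualIdempotent_mem_T D _) (distanceMatrix_mem_T D 1))
      (dualIdempotent_mem_T D _)

end FoldedCube

/-! ### Identification of the algebra and the main theorem -/

namespace FoldedCube

theorem T_eq_range_blockEmbedding {D : ℕ} {ι : Fin (D + 1) → Type*} [∀ r, Fintype (ι r)]
    [∀ r, DecidableEq (ι r)] (B : ∀ r : Fin (D + 1), OrthonormalBasis (ι r) ℂ (L D r)) :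
    T D = (blockEmbedding B).range := by
  refine le_antisymm (Algebra.adjoin_le ?_)
    (range_blockEmbedding_le B (fun _ _ => M_up_mem_T) (fun _ _ => M_down_mem_T))
  have hdist : boseMesner (graph D) ≤ Subalgebra.toSubmodule (blockEmbedding B).range := by
    refine Submodule.span_le.2 ?_
    rintro _ ⟨k, rfl⟩
    exact mem_range_blockEmbedding_of_card B
      (fun i j t => if min (i + j - 2 * t) (2 * D + 1 - (i + j - 2 * t)) = k then 1 else 0)
      (distanceMatrix_apply D k)
  have hdual : dualBoseMesner (graph D) (zero D) ≤
      Subalgebra.toSubmodule (blockEmbedding B).range := by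
    refine Submodule.span_le.2 ?_
    rintro _ ⟨k, rfl⟩
    rw [dualIdempotent_eq]
    exact mem_range_blockEmbedding_of_card B
      (fun i j t => if i = k ∧ j = k ∧ t = k then 1 else 0) (M_apply D k k k)
  exact Set.union_subset hdist hdual

end FoldedCube

theorem mainTheorem6 (D : ℕ) (hD : 3 ≤ D)
    {ι : Fin (D + 1) → Type*} [∀ r, Fintype (ι r)] [∀ r, DecidableEq (ι r)]
    (B : ∀ r : Fin (D + 1), OrthonormalBasis (ι r) ℂ (FoldedCube.L D r)) :
    -- the number of copies of the `r`-th block is `C(2D+1, r) - C(2D+1, r-1)`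
    (∀ r : Fin (D + 1), (Fintype.card (ι r) : ℤ) =
      ((2 * D + 1).choose r : ℤ) -
        (if (r : ℕ) = 0 then 0 else ((2 * D + 1).choose ((r : ℕ) - 1) : ℤ))) ∧
    -- `U'` is unitary
    (FoldedCube.U B)ᴴ * FoldedCube.U B = 1 ∧
    FoldedCube.U B * (FoldedCube.U B)ᴴ = 1 ∧
    -- conjugation by `U'` puts `T` in block diagonal form, and keeping one copy of each block is an
    -- isomorphism of `T` onto the direct sum of full matrix algebras
    ∃ φ : FoldedCube.T D ≃ₐ[ℂ]
        ((r : Fin (D + 1)) → Matrix (FoldedCube.N D r) (FoldedCube.N D r) ℂ),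
      ∀ Y : FoldedCube.T D,
        (FoldedCube.U B)ᴴ * (Y : Matrix (FoldedCube.Vertex D) (FoldedCube.Vertex D) ℂ) *
            FoldedCube.U B =
          Matrix.blockDiagonal' fun r => (1 : Matrix (ι r) (ι r) ℂ) ⊗ₖ φ Y r := by

  refine ⟨(FoldedCube.card_basis_and_card_tripleIndex B).1, FoldedCube.conjTranspose_U_mul_U B,
    FoldedCube.U_mul_conjTranspose_U B,
    ((AlgEquiv.ofInjective (FoldedCube.blockEmbedding B)
      (FoldedCube.blockEmbedding_injective B)).trans
      (Subalgebra.equivOfEq _ _ (FoldedCube.T_eq_range_blockEmbedding B).symm)).symm, ?_⟩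
  intro Y
  -- Since $\varphi$ is the inverse of the embedding onto its image $T$, it suffices to treat $Y$
  -- given by its blocks $Z$.
  obtain ⟨Z, rfl⟩ := ((AlgEquiv.ofInjective (FoldedCube.blockEmbedding B)
      (FoldedCube.blockEmbedding_injective B)).trans
      (Subalgebra.equivOfEq _ _ (FoldedCube.T_eq_range_blockEmbedding B).symm)).surjective Y
  rw [AlgEquiv.symm_apply_apply]
  exact FoldedCube.conjTranspose_U_mul_blockEmbedding_mul_U B Z
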